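/- Let $\Gamma$ be the Gamma function and $$\delta_c=\left(\frac{\Gamma(1/4)^4}{8\pi^2}+\frac{8\pi^2}{\Gamma(1/4)^4}\right)^{-1}.$$ For $t>1$ and $\nu=\pm\frac12$ let $$Q_\nu(t)=\int_0^{t-\sqrt{t^2-1}}\frac{x^\nu}{\sqrt{x^2-2tx+1}}\,dx$$ be the Legendre function of the second kind, and for $r,r'>0$ put $e(r)=\sqrt{r^2+1}$, $n(r)=\sqrt{2e(r)(e(r)+1)}$ and $$K_0(r,r')=\frac{(e(r)+1)(e(r')+1)}{n(r)n(r')}\,Q_{-1/2}\!\left(\tfrac12\left(\tfrac r{r'}+\tfrac{r'}r\right)\right)+\frac{rr'}{n(r)n(r')}\,Q_{1/2}\!\left(\tfrac12\left(\tfrac r{r'}+\tfrac{r'}r\right)\right).$$ For $\delta\in\mathbb R$ and complex-valued $f\in L^2\big((0,\infty),\sqrt{1+r^2}\,dr\big)$ put $$\langle f,b_0f\rangle=\int_0^\infty e(r)|f(r)|^2\,dr-\frac{\delta}{\pi}\int_0^\infty\!\!\int_0^\infty f(r)\overline{f(r')}\,K_0(r,r')\,dr\,dr',\qquad \|f\|^2=\int_0^\infty|f(r)|^2\,dr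 .$$ **Theorem.** Let $\delta>\delta_c$. Then the form $b_0$ is unbounded from below: for every $M\in\mathbb R$ there is $f\in L^2\big((0,\infty),\sqrt{1+r^2}\,dr\big)$ with $\|f\|=1$, for which the double integral converges absolutely, and $\langle f,b_0f\rangle<M$. Moreover, there is a constant $C$ (depending only on $\delta$) such that for all $1<a<b$ the function $f_{a,b}(p)=\chi_{(a,b)}(p)/p$ lies in $L^2\big((0,\infty),\sqrt{1+r^2}\,dr\big)$, its double integral converges absolutely, $\|f_{a,b}\|^2=\frac1a-\frac1b\le1$, and $$\left|\langle f_{a,b},b_0f_{a,b}\rangle-\left(1-\frac{\delta}{\delta_c}\right)\ln\frac ba\right|\le C\left(\frac1a\ln\frac ba+1\right).$$ Furthermore, the integrals $I_\nu=\int_0^\infty\frac1p\,Q_\nu\!\left(\frac12\left(p+\frac1p\right)\right)dp$ converge absolutely for $\nu=\pm\frac12$, and $$I_{-1/2}=\frac{\Gamma(1/4)^4}{4\pi},\qquad I_{1/2}=\frac{16\pi^3}{\Gamma(1/4)^4}.$$ -/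

import Mathlib

open Real Set MeasureTheory

noncomputable section

namespace BrownRavenhall

/-- The critical coupling constant. -/
def deltaC : ℝ :=
  (Real.Gamma (1 / 4) ^ 4 / (8 * π ^ 2) + 8 * π ^ 2 / Real.Gamma (1 / 4) ^ 4)⁻¹

/-- The Legendre function of the second kind `Q_ν(t)`, for real `ν > -1` and `t > 1`. -/
def legendreQ (ν t : ℝ) : ℝ :=
  ∫ x in Ioo 0 (t - √(t ^ 2 - 1)), x ^ ν / √(x ^ 2 - 2 * t * x + 1)

def e (r : ℝ) : ℝ := √(r ^ 2 + 1)

def n (r : ℝ) : ℝ := √(2 * e r * (e r + 1))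

def beta1 (r s : ℝ) : ℝ := (e r + 1) * (e s + 1) / (n r * n s)

def beta2 (r s : ℝ) : ℝ := r * s / (n r * n s)

/-- The kernel `K₀` of the partial wave `k = 0`. -/
def K0 (r s : ℝ) : ℝ :=
  beta1 r s * legendreQ (-(1 / 2)) ((r / s + s / r) / 2) +
    beta2 r s * legendreQ (1 / 2) ((r / s + s / r) / 2)

/-- `f ∈ L²((0, ∞), √(1 + r²) dr)`. -/
def InFormDomain (f : ℝ → ℂ) : Prop :=
  MemLp f 2 ((volume.restrict (Ioi 0)).withDensity fun r => ENNReal.ofReal (√(1 + r ^ 2)))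

/-- The squared norm of `f` in `L²((0, ∞), dr)`. -/
def normSq (f : ℝ → ℂ) : ℝ := ∫ r in Ioi 0, ‖f r‖ ^ 2

/-- The integrand of the potential part of the form. -/
def potentialIntegrand (f : ℝ → ℂ) (z : ℝ × ℝ) : ℂ :=
  f z.1 * (starRingEnd ℂ) (f z.2) * (K0 z.1 z.2 : ℂ)

def potential (f : ℝ → ℂ) : ℂ :=
  ∫ z in Ioi (0 : ℝ) ×ˢ Ioi (0 : ℝ), potentialIntegrand f z

/-- The value `⟨f, b₀ f⟩` at coupling `δ`. The double integral is real because the kernel is real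
and symmetric (`potential_im`), so that taking the real part only changes its type. -/
def b0 (δ : ℝ) (f : ℝ → ℂ) : ℝ :=
  (∫ r in Ioi 0, e r * ‖f r‖ ^ 2) - δ / π * (potential f).re

/-- The function `χ_{(a,b)}(p) / p`. -/
def trial (a b : ℝ) : ℝ → ℂ := (Ioo a b).indicator fun p => ((1 / p : ℝ) : ℂ)

theorem K0_symm (r s : ℝ) : K0 r s = K0 s r := by
  unfold K0 beta1 beta2
  rw [add_comm (r / s) (s / r), mul_comm (n r) (n s), mul_comm (e r + 1), mul_comm r s]

theorem potential_im (f : ℝ → ℂ) : (potential f).im = 0 := by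
  rw [← Complex.conj_eq_iff_im]
  unfold potential
  rw [← integral_conj, Measure.volume_eq_prod, ← Measure.prod_restrict,
    ← integral_prod_swap (potentialIntegrand f)]
  congr 1
  funext z
  simp only [potentialIntegrand, map_mul, Complex.conj_conj, Complex.conj_ofReal, Prod.fst_swap,
    Prod.snd_swap]
  rw [K0_symm z.2 z.1]
  ring

end BrownRavenhall

end

noncomputable section

open scoped ENNReal

namespace BrownRavenhall

/-! The heart of the matter is a factorization. With `φ(z) = z ^ ν / √(1 - z ^ 2)` on `(0, 1)`, the
substitution `x = p z ^ 2` turns `Q_ν((p + 1 / p) / 2) / p` into the multiplicative autocorrelation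
`A(p) = 2 ∫ z φ(z) φ(p z) dz` (`legendreQ_joukowski_div`). By Tonelli, the moment `∫ p ^ c A(p) dp`
is twice the product of the moments of `φ` with exponents `ν + c` and `ν - c`
(`lintegral_rpow_mul_arcCorrelation`), which are Beta integrals. The case `c = 0` gives `I_ν`, and
`c = ±1/4` shows that `∫ |log p| A(p) dp` is finite.

On `χ_(a,b)(p) / p` the potential becomes an integral over `(a, b)²` of a kernel homogeneous of
degree `-2`, up to slowly varying weights. In the variables `p = r / s` and `s` it equals `I_ν log
(b / a)` minus a boundary loss, and the loss is at most the logarithmic moment, uniformly in `a` and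
`b` (`le_lintegral_square_add`). Both weights are within `1 / (2a)` of `1 / 2`, and `r ≤ e r ≤ r +
1` gives a kinetic energy `log (b / a) + O(1)`. Since `1 / δ_c = (I_{-1/2} + I_{1/2}) / (2π)`, the
coefficient of the logarithm is `1 - δ / δ_c`, negative for `δ > δ_c`. A large fixed `a` and then `b
→ ∞` drive the form to `-∞`; normalization only helps, because the norm is at most `1`. -/

theorem lintegral_Ioi_zero_comp_mul_right (f : ℝ → ℝ≥0∞) {s : ℝ} (hs : 0 < s) :
    ENNReal.ofReal s * ∫⁻ p in Ioi 0, f (p * s) = ∫⁻ r in Ioi 0, f r := by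
  have h := lintegral_image_eq_lintegral_abs_deriv_mul (s := Ioi (0 : ℝ)) (f := fun p => p * s)
    (f' := fun _ => s) measurableSet_Ioi
    (fun x _ => by simpa using ((hasDerivAt_id x).mul_const s).hasDerivWithinAt)
    ((mul_left_injective₀ hs.ne').injOn) f
  have him : (fun p => p * s) '' Ioi 0 = Ioi 0 := by
    ext y
    exact ⟨fun ⟨x, hx, hxy⟩ => hxy ▸ mul_pos hx hs,
      fun hy => ⟨y / s, div_pos hy hs, div_mul_cancel₀ y hs.ne'⟩⟩
  rw [him] at h
  rw [h, lintegral_const_mul' _ _ (by simp), abs_of_pos hs]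

/-! ### Mellin transform of the autocorrelation and Beta integrals. -/

/-- The function `z ^ ν / √(1 - z ^ 2)` on `(0, 1)`, extended by zero. -/
def arcDensity (ν : ℝ) : ℝ → ℝ≥0∞ :=
  (Ioo 0 1).indicator fun z => ENNReal.ofReal (z ^ ν / √(1 - z ^ 2))

@[fun_prop]
theorem measurable_arcDensity (ν : ℝ) : Measurable (arcDensity ν) := by
  unfold arcDensity
  exact Measurable.indicator (by fun_prop) measurableSet_Ioo

theorem rpow_mul_arcDensity (ν c : ℝ) {z : ℝ} (hz : 0 < z) :
    ENNReal.ofReal (z ^ c) * arcDensity ν z = arcDensity (ν + c) z := by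
  unfold arcDensity
  by_cases h : z ∈ Ioo (0 : ℝ) 1
  · rw [indicator_of_mem h, indicator_of_mem h, ← ENNReal.ofReal_mul (by positivity),
      rpow_add hz]
    congr 1
    ring
  · simp [indicator_of_notMem h]

/-- The multiplicative autocorrelation of `arcDensity ν`. -/
def arcCorrelation (ν p : ℝ) : ℝ≥0∞ :=
  2 * ∫⁻ z in Ioi 0, ENNReal.ofReal z * (arcDensity ν z * arcDensity ν (p * z))

@[fun_prop]
theorem measurable_arcCorrelation (ν : ℝ) : Measurable (arcCorrelation ν) := by
  unfold arcCorrelation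
  refine Measurable.const_mul ?_ _
  exact Measurable.lintegral_prod_right'
    (f := fun w : ℝ × ℝ => ENNReal.ofReal w.2 * (arcDensity ν w.2 * arcDensity ν (w.1 * w.2)))
    (by fun_prop)

/-- Mellin transforms take multiplicative correlations to products: for fixed `z` put `v = p z`, so
that `p ^ c = v ^ c z ^ (-c)` and the variables separate. Working in `[0, ∞]`, Tonelli needs no
integrability. -/
theorem lintegral_rpow_mul_arcCorrelation (ν c : ℝ) :
    ∫⁻ p in Ioi 0, ENNReal.ofReal (p ^ c) * arcCorrelation ν p =
      2 * ((∫⁻ z in Ioi 0, arcDensity (ν + c) z) * ∫⁻ z in Ioi 0, arcDensity (ν - c) z) := by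
  have h1 : ∀ p : ℝ, ENNReal.ofReal (p ^ c) * arcCorrelation ν p =
      2 * ∫⁻ z in Ioi 0, ENNReal.ofReal (p ^ c) *
        (ENNReal.ofReal z * (arcDensity ν z * arcDensity ν (p * z))) := by
    intro p
    rw [arcCorrelation, lintegral_const_mul _ (by fun_prop), mul_left_comm]
  simp_rw [h1]
  rw [lintegral_const_mul' _ _ (by simp), lintegral_lintegral_swap (by fun_prop)]
  congr 1
  have h2 : ∀ z ∈ Ioi (0 : ℝ), (∫⁻ p in Ioi 0, ENNReal.ofReal (p ^ c) *
        (ENNReal.ofReal z * (arcDensity ν z * arcDensity ν (p * z)))) =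
      arcDensity (ν - c) z * ∫⁻ v in Ioi 0, arcDensity (ν + c) v := by
    intro z hz
    have hz : 0 < z := hz
    rw [← lintegral_Ioi_zero_comp_mul_right (arcDensity (ν + c)) hz, ← mul_assoc,
      ← lintegral_const_mul _ (by fun_prop)]
    refine setLIntegral_congr_fun measurableSet_Ioi fun p hp => ?_
    have hp : 0 < p := hp
    rw [← rpow_mul_arcDensity ν c (mul_pos hp hz), sub_eq_add_neg,
      ← rpow_mul_arcDensity ν (-c) hz, mul_rpow hp.le hz.le, ENNReal.ofReal_mul (by positivity)]
    have : ENNReal.ofReal (z ^ (-c)) * ENNReal.ofReal (z ^ c) = 1 := by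
      rw [← ENNReal.ofReal_mul (by positivity), ← rpow_add hz]; simp
    calc _ = ENNReal.ofReal (p ^ c) *
        (ENNReal.ofReal z * (arcDensity ν z * arcDensity ν (p * z))) * 1 := by rw [mul_one]
      _ = _ := by rw [← this]; ring
  rw [setLIntegral_congr_fun measurableSet_Ioi h2, lintegral_mul_const _ (by fun_prop), mul_comm]

theorem lintegral_beta {α β : ℝ} (hα : 0 < α) (hβ : 0 < β) :
    ∫⁻ x in Ioo (0 : ℝ) 1, ENNReal.ofReal (x ^ (α - 1) * (1 - x) ^ (β - 1)) =
      ENNReal.ofReal (ProbabilityTheory.beta α β) := by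
  have hB := ProbabilityTheory.beta_pos hα hβ
  have h := ProbabilityTheory.lintegral_betaPDF_eq_one hα hβ
  rw [ProbabilityTheory.lintegral_betaPDF] at h
  simp_rw [mul_assoc, ENNReal.ofReal_mul (one_div_pos.2 hB).le] at h
  rw [lintegral_const_mul' _ _ (by simp)] at h
  have h' := congrArg (ENNReal.ofReal (ProbabilityTheory.beta α β) * ·) h
  simp only [← mul_assoc, ← ENNReal.ofReal_mul hB.le, mul_one_div_cancel hB.ne',
    ENNReal.ofReal_one, one_mul, mul_one] at h'
  exact h'

/-- The substitution `x = z ^ 2` produces the Beta integrand with exponents `(σ + 1) / 2 - 1` and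
`-1 / 2`. -/
theorem lintegral_arcDensity {σ : ℝ} (hσ : -1 < σ) :
    ∫⁻ z in Ioi 0, arcDensity σ z =
      ENNReal.ofReal (ProbabilityTheory.beta ((σ + 1) / 2) (1 / 2) / 2) := by
  have him : (fun z : ℝ => z ^ 2) '' Ioo 0 1 = Ioo 0 1 := by
    ext y
    constructor
    · rintro ⟨z, hz, rfl⟩
      exact ⟨by have := hz.1; positivity, by nlinarith [hz.1, hz.2]⟩
    · intro hy
      exact ⟨√y, ⟨sqrt_pos.2 hy.1, by rw [sqrt_lt' one_pos]; simpa using hy.2⟩, sq_sqrt hy.1.le⟩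
  have h := lintegral_image_eq_lintegral_abs_deriv_mul (s := Ioo (0 : ℝ) 1) (f := fun z => z ^ 2)
    (f' := fun z => 2 * z) measurableSet_Ioo
    (fun x _ => by simpa using (hasDerivAt_pow 2 x).hasDerivWithinAt)
    (fun x hx y hy hxy => (pow_left_inj₀ hx.1.le hy.1.le two_ne_zero).1 hxy)
    (fun x => ENNReal.ofReal (x ^ ((σ + 1) / 2 - 1) * (1 - x) ^ ((1 / 2 : ℝ) - 1)))
  rw [him, lintegral_beta (by linarith) (by norm_num)] at h
  rw [ENNReal.ofReal_div_of_pos two_pos, h]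
  have h2 : ∀ z ∈ Ioo (0 : ℝ) 1, ENNReal.ofReal |2 * z| *
      ENNReal.ofReal ((z ^ 2) ^ ((σ + 1) / 2 - 1) * (1 - z ^ 2) ^ ((1 / 2 : ℝ) - 1)) =
      ENNReal.ofReal 2 * ENNReal.ofReal (z ^ σ / √(1 - z ^ 2)) := by
    intro z hz
    have hz0 := hz.1
    have h1 : 0 < 1 - z ^ 2 := by nlinarith [hz.1, hz.2]
    rw [← ENNReal.ofReal_mul (by positivity), ← ENNReal.ofReal_mul (by positivity)]
    congr 1
    rw [abs_of_pos (by positivity), show (1 / 2 : ℝ) - 1 = -(1 / 2) by norm_num,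
      rpow_neg h1.le, ← sqrt_eq_rpow, ← rpow_natCast_mul hz0.le,
      show ((2 : ℕ) : ℝ) * ((σ + 1) / 2 - 1) = σ - 1 by push_cast; ring, rpow_sub_one hz0.ne']
    field_simp
  rw [setLIntegral_congr_fun measurableSet_Ioo h2, lintegral_const_mul' _ _ (by simp),
    mul_comm, mul_div_assoc, ENNReal.div_self (by simp) (by simp), mul_one]
  unfold arcDensity
  rw [setLIntegral_indicator measurableSet_Ioo, inter_eq_self_of_subset_left Ioo_subset_Ioi_self]

theorem lintegral_arcDensity_ne_top {σ : ℝ} (hσ : -1 < σ) :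
    ∫⁻ z in Ioi 0, arcDensity σ z ≠ ∞ := by
  rw [lintegral_arcDensity hσ]
  exact ENNReal.ofReal_ne_top

/-! ### The Legendre function as an autocorrelation, and the integrals `I_ν`. -/

theorem sub_sqrt_joukowski {p : ℝ} (hp : 0 < p) :
    (p + 1 / p) / 2 - √(((p + 1 / p) / 2) ^ 2 - 1) = min p (1 / p) := by
  rw [show ((p + 1 / p) / 2) ^ 2 - 1 = ((p - 1 / p) / 2) ^ 2 by field_simp; ring, sqrt_sq_eq_abs]
  rcases le_total p (1 / p) with h | h
  · rw [min_eq_left h, abs_of_nonpos (by linarith)]; ring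
  · rw [min_eq_right h, abs_of_nonneg (by linarith)]; ring

/-- At `t = (p + 1 / p) / 2` the quadratic is `(x - p)(x - 1 / p)`, which for `x = p z ^ 2` equals
`(1 - z ^ 2)(1 - (p z) ^ 2)`. The upper limit `min p (1 / p)` becomes `z = min 1 (1 / p)`, the exact
range where both `z` and `p z` lie in `(0, 1)`. -/
theorem legendreQ_joukowski_div (ν : ℝ) {p : ℝ} (hp : 0 < p) :
    1 / p * legendreQ ν ((p + 1 / p) / 2) = (arcCorrelation ν p).toReal := by
  set m := min 1 (1 / p) with hm
  have hmem : ∀ z, z ∈ Ioo 0 m ↔ z ∈ Ioo (0 : ℝ) 1 ∧ p * z ∈ Ioo (0 : ℝ) 1 := by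
    intro z
    simp only [mem_Ioo, hm, lt_min_iff, lt_div_iff₀ hp, mul_comm z p]
    constructor
    · rintro ⟨h0, h1, h2⟩; exact ⟨⟨h0, h1⟩, by positivity, h2⟩
    · rintro ⟨⟨h0, h1⟩, _, h2⟩; exact ⟨h0, h1, h2⟩
  have him : (fun z : ℝ => p * z ^ 2) '' Ioo 0 m = Ioo 0 (min p (1 / p)) := by
    have hm0 : 0 < m := lt_min one_pos (by positivity)
    have hm2 : min p (1 / p) = p * m ^ 2 := by
      rcases le_total p 1 with h | h
      · have : 1 ≤ 1 / p := by rwa [le_div_iff₀ hp, one_mul]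
        rw [hm, min_eq_left (h.trans this), min_eq_left this]; ring
      · have : 1 / p ≤ 1 := by rwa [div_le_iff₀ hp, one_mul]
        rw [hm, min_eq_right (this.trans h), min_eq_right this]; field_simp
    rw [hm2]
    ext y
    constructor
    · rintro ⟨z, ⟨h0, h1⟩, rfl⟩
      refine ⟨by positivity, ?_⟩
      show p * z ^ 2 < p * m ^ 2
      gcongr
    · rintro ⟨h0, h1⟩
      refine ⟨√(y / p), ⟨sqrt_pos.2 (by positivity), ?_⟩, ?_⟩
      · rw [sqrt_lt' hm0, div_lt_iff₀ hp]; linarith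
      · simp only [sq_sqrt (div_pos h0 hp).le]; field_simp
  have hcov := integral_image_eq_integral_abs_deriv_smul (s := Ioo (0 : ℝ) m)
    (f := fun z => p * z ^ 2) (f' := fun z => p * (2 * z)) measurableSet_Ioo
    (fun x _ => by simpa using ((hasDerivAt_pow 2 x).const_mul p).hasDerivWithinAt)
    (fun x hx y hy hxy => (pow_left_inj₀ hx.1.le hy.1.le two_ne_zero).1
      (mul_left_cancel₀ hp.ne' hxy))
    (fun x => x ^ ν / √(x ^ 2 - 2 * ((p + 1 / p) / 2) * x + 1))
  unfold legendreQ
  rw [sub_sqrt_joukowski hp, ← him, hcov, ← integral_const_mul]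
  have hpt : ∀ z ∈ Ioo 0 m, 1 / p * (|p * (2 * z)| • ((p * z ^ 2) ^ ν /
      √((p * z ^ 2) ^ 2 - 2 * ((p + 1 / p) / 2) * (p * z ^ 2) + 1))) =
      2 * (z * (z ^ ν / √(1 - z ^ 2) * ((p * z) ^ ν / √(1 - (p * z) ^ 2)))) := by
    intro z hz
    obtain ⟨⟨h0, h1⟩, h2, h3⟩ := (hmem z).1 hz
    have h4 : 0 ≤ 1 - z ^ 2 := by nlinarith
    rw [show (p * z ^ 2) ^ 2 - 2 * ((p + 1 / p) / 2) * (p * z ^ 2) + 1 =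
      (1 - z ^ 2) * (1 - (p * z) ^ 2) by field_simp; ring, sqrt_mul h4,
      abs_of_pos (by positivity), show p * z ^ 2 = z * (p * z) by ring, mul_rpow h0.le h2.le,
      smul_eq_mul]
    rw [← mul_div_mul_comm]
    field_simp
  -- No integrability is required here: if the integral diverges, as at `p = 1` for `ν = ±1/2`, both
  -- sides take the default value `0`.
  rw [setIntegral_congr_fun measurableSet_Ioo hpt, integral_eq_lintegral_of_nonneg_ae]
  · congr 1
    rw [arcCorrelation, ← lintegral_const_mul _ (by fun_prop),
      ← inter_eq_self_of_subset_left (s := Ioo 0 m) (t := Ioi 0) Ioo_subset_Ioi_self,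
      ← setLIntegral_indicator measurableSet_Ioo]
    refine lintegral_congr fun z => ?_
    by_cases hz : z ∈ Ioo 0 m
    · obtain ⟨h1, h2⟩ := (hmem z).1 hz
      have := h1.1
      have := h2.1
      rw [indicator_of_mem hz, arcDensity, indicator_of_mem h1, indicator_of_mem h2,
        ENNReal.ofReal_mul (by positivity), ENNReal.ofReal_mul (by positivity),
        ENNReal.ofReal_mul (by positivity)]
      simp
    · rw [indicator_of_notMem hz]
      rw [hmem, not_and_or] at hz
      rcases hz with h | h <;> simp [arcDensity, indicator_of_notMem h]
  · refine ae_restrict_of_forall_mem measurableSet_Ioo fun z hz => ?_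
    obtain ⟨⟨h0, h1⟩, h2, h3⟩ := (hmem z).1 hz
    simp only [Pi.zero_apply]
    positivity
  · exact Measurable.aestronglyMeasurable (by fun_prop)

theorem lintegral_arcCorrelation_ne_top {ν c : ℝ} (h1 : -1 < ν + c) (h2 : -1 < ν - c) :
    ∫⁻ p in Ioi 0, ENNReal.ofReal (p ^ c) * arcCorrelation ν p ≠ ∞ := by
  rw [lintegral_rpow_mul_arcCorrelation]
  exact ENNReal.mul_ne_top (by simp)
    (ENNReal.mul_ne_top (lintegral_arcDensity_ne_top h1) (lintegral_arcDensity_ne_top h2))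

theorem lintegral_arcCorrelation {ν : ℝ} (hν : -1 < ν) :
    ∫⁻ p in Ioi 0, arcCorrelation ν p =
      ENNReal.ofReal (ProbabilityTheory.beta ((ν + 1) / 2) (1 / 2) ^ 2 / 2) := by
  have h := lintegral_rpow_mul_arcCorrelation ν 0
  simp only [rpow_zero, ENNReal.ofReal_one, one_mul, add_zero, sub_zero] at h
  have hB := ProbabilityTheory.beta_pos (α := (ν + 1) / 2) (β := 1 / 2) (by linarith) (by norm_num)
  rw [h, lintegral_arcDensity hν, ← ENNReal.ofReal_mul (by positivity),
    ← ENNReal.ofReal_ofNat, ← ENNReal.ofReal_mul (by positivity)]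
  congr 1
  ring

theorem arcCorrelation_ae_lt_top {ν : ℝ} (hν : -1 < ν) :
    ∀ᵐ p ∂volume.restrict (Ioi 0), arcCorrelation ν p < ∞ :=
  ae_lt_top (by fun_prop) (by rw [lintegral_arcCorrelation hν]; simp)

theorem integrableOn_legendreQ {ν : ℝ} (hν : -1 < ν) :
    IntegrableOn (fun p : ℝ => 1 / p * legendreQ ν ((p + 1 / p) / 2)) (Ioi 0) := by
  have h : IntegrableOn (fun p => (arcCorrelation ν p).toReal) (Ioi 0) :=
    integrable_toReal_of_lintegral_ne_top (by fun_prop)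
      (by rw [lintegral_arcCorrelation hν]; simp)
  exact h.congr_fun (fun p hp => (legendreQ_joukowski_div ν hp).symm) measurableSet_Ioi

theorem integral_legendreQ {ν : ℝ} (hν : -1 < ν) :
    ∫ p in Ioi (0 : ℝ), 1 / p * legendreQ ν ((p + 1 / p) / 2) =
      ProbabilityTheory.beta ((ν + 1) / 2) (1 / 2) ^ 2 / 2 := by
  rw [setIntegral_congr_fun measurableSet_Ioi (fun p hp => legendreQ_joukowski_div ν hp),
    integral_toReal (by fun_prop) (arcCorrelation_ae_lt_top hν), lintegral_arcCorrelation hν,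
    ENNReal.toReal_ofReal (by positivity)]

theorem Gamma_three_quarters : Real.Gamma (3 / 4) = π * √2 / Real.Gamma (1 / 4) := by
  have h := Real.Gamma_mul_Gamma_one_sub (1 / 4)
  have hG : 0 < Real.Gamma (1 / 4) := Real.Gamma_pos_of_pos (by norm_num)
  rw [show (1 : ℝ) - 1 / 4 = 3 / 4 by norm_num, show π * (1 / 4) = π / 4 by ring,
    sin_pi_div_four] at h
  rw [eq_div_iff hG.ne', mul_comm, h]
  have : √2 * √2 = 2 := mul_self_sqrt (by norm_num)
  field_simp
  linarith

theorem integral_legendreQ_neg_half :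
    ∫ p in Ioi (0 : ℝ), 1 / p * legendreQ (-(1 / 2)) ((p + 1 / p) / 2) =
      Real.Gamma (1 / 4) ^ 4 / (4 * π) := by
  have hG : 0 < Real.Gamma (1 / 4) := Real.Gamma_pos_of_pos (by norm_num)
  rw [integral_legendreQ (by norm_num), ProbabilityTheory.beta, Real.Gamma_one_half_eq,
    show (-(1 / 2) + 1 : ℝ) / 2 = 1 / 4 by norm_num,
    show (1 / 4 + 1 / 2 : ℝ) = 3 / 4 by norm_num, Gamma_three_quarters]
  have h2 : √2 ^ 2 = 2 := sq_sqrt (by norm_num)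
  have hpi : √π ^ 2 = π := sq_sqrt pi_pos.le
  field_simp
  rw [h2, hpi]
  ring

theorem integral_legendreQ_half :
    ∫ p in Ioi (0 : ℝ), 1 / p * legendreQ (1 / 2) ((p + 1 / p) / 2) =
      16 * π ^ 3 / Real.Gamma (1 / 4) ^ 4 := by
  have hG : 0 < Real.Gamma (1 / 4) := Real.Gamma_pos_of_pos (by norm_num)
  rw [integral_legendreQ (by norm_num), ProbabilityTheory.beta, Real.Gamma_one_half_eq,
    show (1 / 2 + 1 : ℝ) / 2 = 3 / 4 by norm_num,
    show (3 / 4 + 1 / 2 : ℝ) = 1 / 4 + 1 by norm_num, Real.Gamma_add_one (by norm_num),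
    Gamma_three_quarters]
  have h2 : √2 ^ 2 = 2 := sq_sqrt (by norm_num)
  have hpi : √π ^ 2 = π := sq_sqrt pi_pos.le
  field_simp
  rw [h2, hpi]
  ring

/-! ### Kernels homogeneous of degree `-2` on the square `(a, b)²`. -/

theorem setLIntegral_one_div {a b : ℝ} (ha : 0 < a) (hab : a ≤ b) :
    ∫⁻ s in Ioo a b, ENNReal.ofReal (1 / s) = ENNReal.ofReal (log (b / a)) := by
  have hi : IntegrableOn (fun s : ℝ => 1 / s) (Ioc a b) := by
    rw [← intervalIntegrable_iff_integrableOn_Ioc_of_le hab]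
    exact intervalIntegral.intervalIntegrable_one_div
      (fun x hx => (ha.trans_le (uIcc_of_le hab ▸ hx).1).ne') continuousOn_id
  rw [← integral_one_div_of_pos ha (ha.trans_le hab), intervalIntegral.integral_of_le hab,
    setLIntegral_congr Ioo_ae_eq_Ioc, ofReal_integral_eq_lintegral_ofReal hi]
  refine ae_restrict_of_forall_mem measurableSet_Ioc fun s hs => ?_
  have := ha.trans hs.1
  simp only [Pi.zero_apply]
  positivity

/-- The `ds / s`-measure of the `s ∈ (a, b)` that multiplication by `p` moves out of `(a, b)`. -/
theorem setLIntegral_one_div_indicator_compl_le {a b p : ℝ} (ha : 0 < a) (hab : a < b)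
    (hp : 0 < p) :
    ∫⁻ s in Ioo a b, ENNReal.ofReal (1 / s) * (Ioo a b)ᶜ.indicator 1 (p * s) ≤
      ENNReal.ofReal |log p| := by
  have hb := ha.trans hab
  -- It suffices to enclose the escaping `s` in an interval of logarithmic length `|log p|`: `[a, a
  -- / p]` if `p ≤ 1`, and `[b / p, b]` if `p ≥ 1`.
  have key : ∀ c d : ℝ, 0 < c → c ≤ d → log (d / c) = |log p| →
      (∀ s ∈ Ioo a b, p * s ∉ Ioo a b → s ∈ Icc c d) →
      ∫⁻ s in Ioo a b, ENNReal.ofReal (1 / s) * (Ioo a b)ᶜ.indicator 1 (p * s) ≤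
      ENNReal.ofReal |log p| := by
    intro c d hc hcd hlog hsub
    rw [← hlog, ← setLIntegral_one_div hc hcd, setLIntegral_congr (Ioo_ae_eq_Icc (a := c)),
      ← lintegral_indicator measurableSet_Ioo, ← lintegral_indicator measurableSet_Icc]
    refine lintegral_mono fun s => ?_
    by_cases hs : s ∈ Ioo a b
    · rw [indicator_of_mem hs]
      by_cases hps : p * s ∈ Ioo a b
      · simp [hps]
      · have : s ∈ Icc c d := hsub s hs hps
        simp [hps, this]
    · simp [indicator_of_notMem hs]
  rcases le_total p 1 with h | h
  · refine key a (a / p) ha (by rw [le_div_iff₀ hp]; nlinarith) ?_ ?_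
    · rw [abs_of_nonpos (log_nonpos hp.le h), ← log_inv]
      congr 1
      field_simp
    · intro s hs hps
      refine ⟨hs.1.le, ?_⟩
      rw [le_div_iff₀ hp]
      by_contra hlt
      exact hps ⟨by linarith, by nlinarith [hs.1, hs.2]⟩
  · refine key (b / p) b (by positivity) (by rw [div_le_iff₀ hp]; nlinarith) ?_ ?_
    · rw [abs_of_nonneg (log_nonneg h)]
      congr 1
      field_simp
    · intro s hs hps
      refine ⟨?_, hs.2.le⟩
      rw [div_le_iff₀ hp]
      by_contra hlt
      exact hps ⟨by nlinarith [hs.1, hs.2], by linarith⟩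

section strip

variable {g : ℝ → ℝ≥0∞} {a b : ℝ}

/-- The substitution `r = p s` has Jacobian `s`, so the factor `1 / s ^ 2` leaves the
scale-invariant measure `ds / s`. -/
theorem lintegral_square_eq (hg : Measurable g) (ha : 0 < a) :
    ∫⁻ z in Ioo a b ×ˢ Ioo a b, ENNReal.ofReal (1 / z.2 ^ 2) * g (z.1 / z.2) =
      ∫⁻ s in Ioo a b, ENNReal.ofReal (1 / s) *
        ∫⁻ p in Ioi 0, (Ioo a b).indicator 1 (p * s) * g p := by
  rw [Measure.volume_eq_prod, ← Measure.prod_restrict, lintegral_prod_symm _ (by fun_prop)]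
  refine setLIntegral_congr_fun measurableSet_Ioo fun s hs => ?_
  have hs0 : 0 < s := ha.trans hs.1
  simp only
  have h1 : Ioo a b ∩ Ioi 0 = Ioo a b :=
    inter_eq_self_of_subset_left fun x hx => ha.trans hx.1
  rw [lintegral_const_mul _ (by fun_prop), ← h1, ← setLIntegral_indicator measurableSet_Ioo,
    ← lintegral_Ioi_zero_comp_mul_right _ hs0, ← mul_assoc, ← ENNReal.ofReal_mul (by positivity),
    h1, show 1 / s ^ 2 * s = 1 / s by field_simp]
  congr 1
  refine lintegral_congr fun p => ?_
  by_cases h : p * s ∈ Ioo a b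
  · simp [indicator_of_mem h, hs0.ne']
  · simp [indicator_of_notMem h]

theorem lintegral_square_le (hg : Measurable g) (ha : 0 < a) (hab : a < b) :
    ∫⁻ z in Ioo a b ×ˢ Ioo a b, ENNReal.ofReal (1 / z.2 ^ 2) * g (z.1 / z.2) ≤
      ENNReal.ofReal (log (b / a)) * ∫⁻ p in Ioi 0, g p := by
  rw [lintegral_square_eq hg ha, ← setLIntegral_one_div ha hab.le,
    ← lintegral_mul_const _ (by fun_prop)]
  gcongr with s p
  by_cases h : p * s ∈ Ioo a b
  · simp [indicator_of_mem h]
  · simp [indicator_of_notMem h]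

/-- Compared with the full product of `ds / s` and `g(p) dp`, only pairs with `p s` outside `(a, b)`
are missing. For each `p` they have `ds / s`-measure at most `|log p|`, a bound free of `a` and `b`.
-/
theorem le_lintegral_square_add (hg : Measurable g) (ha : 0 < a) (hab : a < b) :
    ENNReal.ofReal (log (b / a)) * ∫⁻ p in Ioi 0, g p ≤
      (∫⁻ z in Ioo a b ×ˢ Ioo a b, ENNReal.ofReal (1 / z.2 ^ 2) * g (z.1 / z.2)) +
        ∫⁻ p in Ioi 0, ENNReal.ofReal |log p| * g p := by
  have hm : Measurable ((Ioo a b)ᶜ.indicator (1 : ℝ → ℝ≥0∞)) :=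
    measurable_one.indicator measurableSet_Ioo.compl
  have hm' : Measurable ((Ioo a b).indicator (1 : ℝ → ℝ≥0∞)) :=
    measurable_one.indicator measurableSet_Ioo
  have hsplit : ∀ s : ℝ, ∫⁻ p in Ioi 0, g p =
      (∫⁻ p in Ioi 0, (Ioo a b).indicator 1 (p * s) * g p) +
        ∫⁻ p in Ioi 0, (Ioo a b)ᶜ.indicator 1 (p * s) * g p := by
    intro s
    rw [← lintegral_add_left (by fun_prop)]
    refine lintegral_congr fun p => ?_
    by_cases h : p * s ∈ Ioo a b <;> simp [h]
  have hmeas : Measurable fun s : ℝ => ENNReal.ofReal (1 / s) *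
      ∫⁻ p in Ioi 0, (Ioo a b).indicator 1 (p * s) * g p := by
    refine Measurable.mul (by fun_prop) ?_
    exact Measurable.lintegral_prod_right'
      (f := fun w : ℝ × ℝ => (Ioo a b).indicator 1 (w.2 * w.1) * g w.2) (by fun_prop)
  rw [lintegral_square_eq hg ha, ← setLIntegral_one_div ha hab.le,
    ← lintegral_mul_const _ (by fun_prop)]
  calc ∫⁻ s in Ioo a b, ENNReal.ofReal (1 / s) * ∫⁻ p in Ioi 0, g p
      = ∫⁻ s in Ioo a b, (ENNReal.ofReal (1 / s) *
          (∫⁻ p in Ioi 0, (Ioo a b).indicator 1 (p * s) * g p) + ENNReal.ofReal (1 / s) *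
          ∫⁻ p in Ioi 0, (Ioo a b)ᶜ.indicator 1 (p * s) * g p) := by
        refine lintegral_congr fun s => ?_
        rw [← mul_add, ← hsplit]
    _ = _ := lintegral_add_left hmeas _
    _ ≤ _ := by
        refine add_le_add le_rfl ?_
        have : ∀ s : ℝ, ENNReal.ofReal (1 / s) *
            ∫⁻ p in Ioi 0, (Ioo a b)ᶜ.indicator 1 (p * s) * g p =
            ∫⁻ p in Ioi 0, ENNReal.ofReal (1 / s) * (Ioo a b)ᶜ.indicator 1 (p * s) * g p := by
          intro s
          rw [← lintegral_const_mul _ (by fun_prop)]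
          exact lintegral_congr fun p => (mul_assoc _ _ _).symm
        simp_rw [this]
        rw [lintegral_lintegral_swap (by fun_prop)]
        refine setLIntegral_mono (by fun_prop) fun p hp => ?_
        rw [lintegral_mul_const _ (by fun_prop)]
        gcongr
        exact setLIntegral_one_div_indicator_compl_le ha hab hp

end strip

/-! ### Finite logarithmic moments. -/

theorem abs_log_le_rpow_add_rpow {p : ℝ} (hp : 0 < p) :
    |log p| ≤ 4 * (p ^ (1 / 4 : ℝ) + p ^ (-(1 / 4) : ℝ)) := by
  have h1 := log_le_rpow_div hp.le (show (0 : ℝ) < 1 / 4 by norm_num)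
  have h2 := log_le_rpow_div (inv_pos.2 hp).le (show (0 : ℝ) < 1 / 4 by norm_num)
  rw [log_inv, inv_rpow hp.le, ← rpow_neg hp.le] at h2
  have h3 : 0 < p ^ (1 / 4 : ℝ) := by positivity
  have h4 : 0 < p ^ (-(1 / 4) : ℝ) := by positivity
  rw [abs_le]
  constructor <;> linarith

/-- Bounding `|log p|` by powers `p ^ (±1/4)` costs `1/4` in the exponent, so `ν - 1/4 > -1` is
needed; `ν = -1/2` leaves room. -/
theorem lintegral_abs_log_mul_arcCorrelation_ne_top {ν : ℝ} (hν : -(3 / 4) < ν) :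
    ∫⁻ p in Ioi 0, ENNReal.ofReal |log p| * arcCorrelation ν p ≠ ∞ := by
  refine ne_top_of_le_ne_top (b := 4 *
    ((∫⁻ p in Ioi 0, ENNReal.ofReal (p ^ (1 / 4 : ℝ)) * arcCorrelation ν p) +
      ∫⁻ p in Ioi 0, ENNReal.ofReal (p ^ (-(1 / 4) : ℝ)) * arcCorrelation ν p)) ?_ ?_
  · exact ENNReal.mul_ne_top (by simp) (ENNReal.add_ne_top.2
      ⟨lintegral_arcCorrelation_ne_top (by linarith) (by linarith),
        lintegral_arcCorrelation_ne_top (by linarith) (by linarith)⟩)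
  · rw [← lintegral_add_left (by fun_prop), ← lintegral_const_mul _ (by fun_prop)]
    refine setLIntegral_mono (by fun_prop) fun p hp => ?_
    have hp : 0 < p := hp
    rw [← add_mul, ← ENNReal.ofReal_add (by positivity) (by positivity), ← mul_assoc,
      ← ENNReal.ofReal_ofNat, ← ENNReal.ofReal_mul (by norm_num)]
    gcongr
    exact abs_log_le_rpow_add_rpow hp

/-! ### The Legendre kernel on squares, in real-valued form. -/

@[fun_prop]
theorem measurable_legendreQ (ν : ℝ) : Measurable (legendreQ ν) := by
  -- The domain of integration depends on `t`, so it is moved into an indicator on the plane, where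
  -- measurability of parameter integrals applies.
  have hset : MeasurableSet {w : ℝ × ℝ | w.2 ∈ Ioo 0 (w.1 - √(w.1 ^ 2 - 1))} :=
    (measurableSet_lt measurable_const measurable_snd).inter
      (measurableSet_lt measurable_snd (by fun_prop))
  have hmeas : Measurable ({w : ℝ × ℝ | w.2 ∈ Ioo 0 (w.1 - √(w.1 ^ 2 - 1))}.indicator
      fun w => w.2 ^ ν / √(w.2 ^ 2 - 2 * w.1 * w.2 + 1)) :=
    Measurable.indicator (by fun_prop) hset
  have heq : legendreQ ν = fun t => ∫ x, {w : ℝ × ℝ | w.2 ∈ Ioo 0 (w.1 - √(w.1 ^ 2 - 1))}.indicator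
      (fun w => w.2 ^ ν / √(w.2 ^ 2 - 2 * w.1 * w.2 + 1)) (t, x) := by
    funext t
    rw [legendreQ, ← integral_indicator measurableSet_Ioo]
    rfl
  rw [heq]
  exact (hmeas.stronglyMeasurable.integral_prod_right' (ν := volume)).measurable

/-- The kernel `Q_ν((r / s + s / r) / 2)` with respect to the measure `dr / r ⊗ ds / s`. -/
def legendreKernel (ν : ℝ) (z : ℝ × ℝ) : ℝ :=
  1 / (z.1 * z.2) * legendreQ ν ((z.1 / z.2 + z.2 / z.1) / 2)

@[fun_prop]
theorem measurable_legendreKernel (ν : ℝ) : Measurable (legendreKernel ν) := by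
  unfold legendreKernel
  fun_prop

theorem legendreKernel_eq (ν : ℝ) {z : ℝ × ℝ} (h1 : 0 < z.1) (h2 : 0 < z.2) :
    legendreKernel ν z = 1 / z.2 ^ 2 * (arcCorrelation ν (z.1 / z.2)).toReal := by
  rw [← legendreQ_joukowski_div ν (div_pos h1 h2), legendreKernel, one_div_div, ← mul_assoc]
  congr 1
  field_simp

theorem legendreKernel_nonneg (ν : ℝ) {z : ℝ × ℝ} (h1 : 0 < z.1) (h2 : 0 < z.2) :
    0 ≤ legendreKernel ν z := by
  rw [legendreKernel_eq ν h1 h2]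
  positivity

section square

variable {ν a b : ℝ}

theorem lintegral_legendreKernel_eq (ha : 0 < a) :
    ∫⁻ z in Ioo a b ×ˢ Ioo a b, ENNReal.ofReal (legendreKernel ν z) =
      ∫⁻ z in Ioo a b ×ˢ Ioo a b, ENNReal.ofReal (1 / z.2 ^ 2) *
        ENNReal.ofReal (arcCorrelation ν (z.1 / z.2)).toReal := by
  refine setLIntegral_congr_fun (measurableSet_Ioo.prod measurableSet_Ioo) fun z hz => ?_
  rw [legendreKernel_eq ν (ha.trans hz.1.1) (ha.trans hz.2.1), ENNReal.ofReal_mul (by positivity)]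

/-- The correlation can be infinite at single points, but its integral is finite, so passing to real
values changes it only on a null set. -/
theorem ofReal_toReal_arcCorrelation_ae_eq (hν : -1 < ν) :
    (fun p => ENNReal.ofReal (arcCorrelation ν p).toReal) =ᵐ[volume.restrict (Ioi 0)]
      arcCorrelation ν := by
  filter_upwards [arcCorrelation_ae_lt_top hν] with p hp using ENNReal.ofReal_toReal hp.ne

theorem lintegral_legendreKernel_le (hν : -1 < ν) (ha : 0 < a) (hab : a < b) :
    ∫⁻ z in Ioo a b ×ˢ Ioo a b, ENNReal.ofReal (legendreKernel ν z) ≤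
      ENNReal.ofReal (log (b / a)) * ∫⁻ p in Ioi 0, arcCorrelation ν p := by
  rw [lintegral_legendreKernel_eq ha,
    ← lintegral_congr_ae (ofReal_toReal_arcCorrelation_ae_eq hν)]
  exact lintegral_square_le (g := fun p => ENNReal.ofReal (arcCorrelation ν p).toReal)
    (by fun_prop) ha hab

theorem le_lintegral_legendreKernel_add (hν : -1 < ν) (ha : 0 < a) (hab : a < b) :
    ENNReal.ofReal (log (b / a)) * ∫⁻ p in Ioi 0, arcCorrelation ν p ≤
      (∫⁻ z in Ioo a b ×ˢ Ioo a b, ENNReal.ofReal (legendreKernel ν z)) +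
        ∫⁻ p in Ioi 0, ENNReal.ofReal |log p| * arcCorrelation ν p := by
  have h := ofReal_toReal_arcCorrelation_ae_eq hν
  have h' : (fun p => ENNReal.ofReal |log p| * ENNReal.ofReal (arcCorrelation ν p).toReal)
      =ᵐ[volume.restrict (Ioi 0)] fun p => ENNReal.ofReal |log p| * arcCorrelation ν p := by
    filter_upwards [h] with p hp
    rw [hp]
  rw [lintegral_legendreKernel_eq ha, ← lintegral_congr_ae h, ← lintegral_congr_ae h']
  exact le_lintegral_square_add (g := fun p => ENNReal.ofReal (arcCorrelation ν p).toReal)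
    (by fun_prop) ha hab

theorem integrableOn_legendreKernel (hν : -1 < ν) (ha : 0 < a) (hab : a < b) :
    IntegrableOn (legendreKernel ν) (Ioo a b ×ˢ Ioo a b) := by
  refine ⟨(measurable_legendreKernel ν).aestronglyMeasurable, ?_⟩
  rw [hasFiniteIntegral_iff_ofReal]
  · refine (lintegral_legendreKernel_le hν ha hab).trans_lt ?_
    rw [lintegral_arcCorrelation hν]
    exact ENNReal.mul_lt_top ENNReal.ofReal_lt_top ENNReal.ofReal_lt_top
  · exact ae_restrict_of_forall_mem (measurableSet_Ioo.prod measurableSet_Ioo) fun z hz =>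
      legendreKernel_nonneg ν (ha.trans hz.1.1) (ha.trans hz.2.1)

/-- The integral of `Q_ν((p + 1 / p) / 2)` over `(0, ∞)` with respect to `dp / p`. -/
def legendreMass (ν : ℝ) : ℝ := ∫ p in Ioi (0 : ℝ), 1 / p * legendreQ ν ((p + 1 / p) / 2)

theorem ofReal_legendreMass (hν : -1 < ν) :
    ENNReal.ofReal (legendreMass ν) = ∫⁻ p in Ioi 0, arcCorrelation ν p := by
  rw [legendreMass, integral_legendreQ hν, lintegral_arcCorrelation hν]

theorem legendreMass_nonneg (hν : -1 < ν) : 0 ≤ legendreMass ν := by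
  rw [legendreMass, integral_legendreQ hν]
  positivity

theorem ofReal_integral_legendreKernel (hν : -1 < ν) (ha : 0 < a) (hab : a < b) :
    ENNReal.ofReal (∫ z in Ioo a b ×ˢ Ioo a b, legendreKernel ν z) =
      ∫⁻ z in Ioo a b ×ˢ Ioo a b, ENNReal.ofReal (legendreKernel ν z) :=
  ofReal_integral_eq_lintegral_ofReal (integrableOn_legendreKernel hν ha hab)
    (ae_restrict_of_forall_mem (measurableSet_Ioo.prod measurableSet_Ioo) fun _ hz =>
      legendreKernel_nonneg ν (ha.trans hz.1.1) (ha.trans hz.2.1))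

theorem integral_legendreKernel_nonneg (ha : 0 < a) :
    0 ≤ ∫ z in Ioo a b ×ˢ Ioo a b, legendreKernel ν z :=
  setIntegral_nonneg (measurableSet_Ioo.prod measurableSet_Ioo) fun _ hz =>
    legendreKernel_nonneg ν (ha.trans hz.1.1) (ha.trans hz.2.1)

theorem log_div_nonneg (ha : 0 < a) (hab : a < b) : 0 ≤ log (b / a) :=
  log_nonneg (by rw [le_div_iff₀ ha]; linarith)

theorem integral_legendreKernel_le (hν : -1 < ν) (ha : 0 < a) (hab : a < b) :
    ∫ z in Ioo a b ×ˢ Ioo a b, legendreKernel ν z ≤ log (b / a) * legendreMass ν := by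
  have h := lintegral_legendreKernel_le hν ha hab
  rwa [← ofReal_integral_legendreKernel hν ha hab, ← ofReal_legendreMass hν,
    ← ENNReal.ofReal_mul (log_div_nonneg ha hab), ENNReal.ofReal_le_ofReal_iff
      (mul_nonneg (log_div_nonneg ha hab) (legendreMass_nonneg hν))] at h

theorem le_integral_legendreKernel_add (hν : -(3 / 4) < ν) (ha : 0 < a) (hab : a < b) :
    log (b / a) * legendreMass ν ≤ (∫ z in Ioo a b ×ˢ Ioo a b, legendreKernel ν z) +
      (∫⁻ p in Ioi 0, ENNReal.ofReal |log p| * arcCorrelation ν p).toReal := by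
  have hν' : -1 < ν := by linarith
  have h := le_lintegral_legendreKernel_add hν' ha hab
  rwa [← ofReal_integral_legendreKernel hν' ha hab, ← ofReal_legendreMass hν',
    ← ENNReal.ofReal_mul (log_div_nonneg ha hab),
    ← ENNReal.ofReal_toReal (lintegral_abs_log_mul_arcCorrelation_ne_top hν),
    ← ENNReal.ofReal_add (integral_legendreKernel_nonneg ha) ENNReal.toReal_nonneg,
    ENNReal.ofReal_le_ofReal_iff (add_nonneg (integral_legendreKernel_nonneg ha)
      ENNReal.toReal_nonneg)] at h

end square

/-! ### The weights `beta1`, `beta2` and the critical constant. -/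

@[fun_prop]
theorem measurable_e : Measurable e := by unfold e; fun_prop

@[fun_prop]
theorem measurable_n : Measurable n := by unfold n; fun_prop

theorem e_pos (r : ℝ) : 0 < e r := sqrt_pos.2 (by positivity)

theorem e_sq (r : ℝ) : e r ^ 2 = r ^ 2 + 1 := sq_sqrt (by positivity)

theorem le_e (r : ℝ) : r ≤ e r := le_sqrt_of_sq_le (by linarith)

theorem n_pos (r : ℝ) : 0 < n r := by
  have := e_pos r
  exact sqrt_pos.2 (by positivity)

theorem n_sq (r : ℝ) : n r ^ 2 = 2 * e r * (e r + 1) := by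
  have := e_pos r
  exact sq_sqrt (by positivity)

theorem e_add_one_div_n_sq (r : ℝ) : ((e r + 1) / n r) ^ 2 = (1 + 1 / e r) / 2 := by
  have := e_pos r
  rw [div_pow, n_sq]
  field_simp

theorem div_n_sq (r : ℝ) : (r / n r) ^ 2 = (1 - 1 / e r) / 2 := by
  have := e_pos r
  rw [div_pow, n_sq, show r ^ 2 = e r ^ 2 - 1 by rw [e_sq]; ring]
  field_simp
  ring

/-- Each weight is a product of a factor in `r` and a factor in `s` whose squares are `(1 ± 1 / e) /
2`; bounds on the squares thus pass to the weight without handling the root in `n`. -/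
theorem mul_mem_Icc_of_sq_mem_Icc {x y c d : ℝ} (hx : 0 ≤ x) (hy : 0 ≤ y) (hc : 0 ≤ c)
    (hx2 : x ^ 2 ∈ Icc c d) (hy2 : y ^ 2 ∈ Icc c d) : x * y ∈ Icc c d := by
  have hd : 0 ≤ d := hc.trans (hx2.1.trans hx2.2)
  constructor
  · refine le_of_sq_le_sq ?_ (by positivity)
    rw [mul_pow, sq c]
    exact mul_le_mul hx2.1 hy2.1 hc (by positivity)
  · refine le_of_sq_le_sq ?_ hd
    rw [mul_pow, sq d]
    exact mul_le_mul hx2.2 hy2.2 (by positivity) hd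

theorem one_div_e_le {a r : ℝ} (ha : 0 < a) (hr : a ≤ r) : 1 / e r ≤ 1 / a :=
  one_div_le_one_div_of_le ha (hr.trans (le_e r))

theorem abs_beta1_sub_le {a r s : ℝ} (ha : 0 < a) (hr : a ≤ r) (hs : a ≤ s) :
    |beta1 r s - 1 / 2| ≤ 1 / (2 * a) := by
  have key : ∀ x, a ≤ x → ((e x + 1) / n x) ^ 2 ∈ Icc (1 / 2) ((1 + 1 / a) / 2) := by
    intro x hx
    have h1 := one_div_e_le ha hx
    have h2 := one_div_pos.2 (e_pos x)
    rw [e_add_one_div_n_sq]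
    constructor <;> linarith
  have hnn : ∀ x, 0 ≤ (e x + 1) / n x := fun x =>
    div_nonneg (by linarith [e_pos x]) (n_pos x).le
  have h := mul_mem_Icc_of_sq_mem_Icc (hnn r) (hnn s) (by norm_num) (key r hr) (key s hs)
  rw [← mul_div_mul_comm] at h
  have h3 : 1 / (2 * a) = 1 / a / 2 := by field_simp
  have h4 : 0 < 1 / a := by positivity
  rw [beta1, abs_le, h3]
  constructor <;> linarith [h.1, h.2]

theorem abs_beta2_sub_le {a r s : ℝ} (ha : 1 < a) (hr : a ≤ r) (hs : a ≤ s) :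
    |beta2 r s - 1 / 2| ≤ 1 / (2 * a) := by
  have ha0 : 0 < a := by linarith
  have key : ∀ x, a ≤ x → (x / n x) ^ 2 ∈ Icc ((1 - 1 / a) / 2) (1 / 2) := by
    intro x hx
    have h1 := one_div_e_le ha0 hx
    have h2 := one_div_pos.2 (e_pos x)
    rw [div_n_sq]
    constructor <;> linarith
  have hnn : ∀ x, a ≤ x → 0 ≤ x / n x := fun x hx => div_nonneg (by linarith) (n_pos x).le
  -- Makes the lower endpoint `(1 - 1 / a) / 2` nonnegative, as the product bound demands.
  have h5 : 1 / a ≤ 1 := by rw [div_le_one ha0]; linarith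
  have h := mul_mem_Icc_of_sq_mem_Icc (hnn r hr) (hnn s hs) (by linarith) (key r hr) (key s hs)
  rw [← mul_div_mul_comm] at h
  have h3 : 1 / (2 * a) = 1 / a / 2 := by field_simp
  have h4 : 0 < 1 / a := by positivity
  rw [beta2, abs_le, h3]
  constructor <;> linarith [h.1, h.2]

/-- Identifies the coefficient of the logarithm: the limiting weight `1 / 2` times the prefactor `1
/ π` times the total mass of the two kernels. -/
theorem one_div_deltaC :
    1 / deltaC = (legendreMass (-(1 / 2)) + legendreMass (1 / 2)) / (2 * π) := by
  have hG : 0 < Real.Gamma (1 / 4) := Real.Gamma_pos_of_pos (by norm_num)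
  rw [legendreMass, legendreMass, integral_legendreQ_neg_half, integral_legendreQ_half, deltaC,
    one_div, inv_inv]
  field_simp
  ring

/-! ### Energy of the trial functions. -/

section trial

variable {a b : ℝ}

theorem Ioo_subset_Ioi_zero (ha : 0 < a) : Ioo a b ⊆ Ioi 0 := fun _ hx => ha.trans hx.1

theorem trial_of_mem {r : ℝ} (hr : r ∈ Ioo a b) : trial a b r = ((1 / r : ℝ) : ℂ) :=
  indicator_of_mem hr _

theorem trial_of_notMem {r : ℝ} (hr : r ∉ Ioo a b) : trial a b r = 0 :=
  indicator_of_notMem hr _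

@[fun_prop]
theorem measurable_trial : Measurable (trial a b) := by
  unfold trial
  exact Measurable.indicator (by fun_prop) measurableSet_Ioo

theorem mul_norm_trial_sq (w : ℝ → ℝ) :
    (fun r => w r * ‖trial a b r‖ ^ 2) = (Ioo a b).indicator fun r => w r * (1 / r ^ 2) := by
  funext r
  by_cases hr : r ∈ Ioo a b
  · rw [trial_of_mem hr, indicator_of_mem hr, Complex.norm_real, Real.norm_eq_abs, sq_abs]
    ring
  · simp [trial_of_notMem hr, indicator_of_notMem hr]

theorem integrableOn_Ioo_of_continuousOn {w : ℝ → ℝ} (ha : 0 < a) (hw : ContinuousOn w (Ioi 0)) :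
    IntegrableOn w (Ioo a b) :=
  ((hw.mono fun _ hx => ha.trans_le hx.1).integrableOn_Icc (a := a) (b := b)).mono_set
    Ioo_subset_Icc_self

theorem continuous_e : Continuous e := by unfold e; fun_prop

theorem continuousOn_mul_one_div_sq {w : ℝ → ℝ} (hw : Continuous w) :
    ContinuousOn (fun r => w r * (1 / r ^ 2)) (Ioi 0) :=
  hw.continuousOn.mul (continuousOn_const.div (by fun_prop) fun r hr => by
    have : 0 < r := hr
    positivity)

theorem integral_one_div_sq (ha : 0 < a) (hab : a < b) :
    ∫ r in Ioo a b, 1 / r ^ 2 = 1 / a - 1 / b := by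
  have hpos : ∀ x ∈ uIcc a b, 0 < x := fun x hx => ha.trans_le (uIcc_of_le hab.le ▸ hx).1
  rw [← integral_Ioc_eq_integral_Ioo, ← intervalIntegral.integral_of_le hab.le,
    intervalIntegral.integral_eq_sub_of_hasDerivAt (f := -fun r => r⁻¹)
      (fun x hx => by simpa using (hasDerivAt_inv (hpos x hx).ne').neg)]
  · simp only [Pi.neg_apply, one_div]; ring
  · exact (continuousOn_const.div (by fun_prop)
      fun x hx => pow_ne_zero 2 (hpos x hx).ne').intervalIntegrable

theorem integral_Ioo_one_div (ha : 0 < a) (hab : a < b) :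
    ∫ r in Ioo a b, 1 / r = log (b / a) := by
  rw [← integral_Ioc_eq_integral_Ioo, ← intervalIntegral.integral_of_le hab.le,
    integral_one_div_of_pos ha (ha.trans hab)]

theorem integral_mul_norm_trial_sq (w : ℝ → ℝ) (ha : 0 < a) :
    ∫ r in Ioi 0, w r * ‖trial a b r‖ ^ 2 = ∫ r in Ioo a b, w r * (1 / r ^ 2) := by
  rw [mul_norm_trial_sq, setIntegral_indicator measurableSet_Ioo,
    inter_eq_self_of_subset_right (Ioo_subset_Ioi_zero ha)]

theorem normSq_trial (ha : 0 < a) (hab : a < b) : normSq (trial a b) = 1 / a - 1 / b := by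
  have h := integral_mul_norm_trial_sq (b := b) (fun _ => 1) ha
  simp only [one_mul] at h
  rw [normSq, h, integral_one_div_sq ha hab]

theorem inFormDomain_trial (ha : 0 < a) : InFormDomain (trial a b) := by
  unfold InFormDomain
  rw [memLp_two_iff_integrable_sq_norm measurable_trial.aestronglyMeasurable,
    integrable_withDensity_iff (by fun_prop) (by simp)]
  have h : (fun r => ‖trial a b r‖ ^ 2 * (ENNReal.ofReal (√(1 + r ^ 2))).toReal) =
      (Ioo a b).indicator fun r => √(1 + r ^ 2) * (1 / r ^ 2) := by
    rw [← mul_norm_trial_sq fun r => √(1 + r ^ 2)]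
    funext r
    rw [ENNReal.toReal_ofReal (by positivity), mul_comm]
  rw [h]
  exact ((integrable_indicator_iff measurableSet_Ioo).2 (integrableOn_Ioo_of_continuousOn ha
    (continuousOn_mul_one_div_sq (by fun_prop)))).mono_measure Measure.restrict_le_self

/-- From `r ≤ e r ≤ r + 1`, the excess over `∫ dr / r` is at most `∫ dr / r ^ 2 = 1 / a - 1 / b`. -/
theorem abs_kinetic_trial_sub_le (ha : 1 < a) (hab : a < b) :
    |(∫ r in Ioi 0, e r * ‖trial a b r‖ ^ 2) - log (b / a)| ≤ 1 := by
  have ha0 : 0 < a := by linarith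
  have hb0 : 0 < b := ha0.trans hab
  rw [integral_mul_norm_trial_sq _ ha0, ← integral_Ioo_one_div ha0 hab]
  have hi : IntegrableOn (fun r => e r * (1 / r ^ 2)) (Ioo a b) :=
    integrableOn_Ioo_of_continuousOn ha0 (continuousOn_mul_one_div_sq continuous_e)
  have hi1 : IntegrableOn (fun r : ℝ => 1 / r) (Ioo a b) :=
    integrableOn_Ioo_of_continuousOn ha0
      (continuousOn_const.div continuousOn_id fun r hr => ne_of_gt hr)
  have hi2 : IntegrableOn (fun r : ℝ => 1 / r ^ 2) (Ioo a b) := by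
    simpa using integrableOn_Ioo_of_continuousOn (b := b) ha0
      (continuousOn_mul_one_div_sq (continuous_const (y := (1 : ℝ))))
  have hlow : ∫ r in Ioo a b, 1 / r ≤ ∫ r in Ioo a b, e r * (1 / r ^ 2) := by
    refine setIntegral_mono_on hi1 hi measurableSet_Ioo fun r hr => ?_
    have hr0 : 0 < r := ha0.trans hr.1
    calc 1 / r = r * (1 / r ^ 2) := by field_simp
      _ ≤ _ := by gcongr; exact le_e r
  have hup : ∫ r in Ioo a b, e r * (1 / r ^ 2) ≤
      (∫ r in Ioo a b, 1 / r) + ∫ r in Ioo a b, 1 / r ^ 2 := by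
    rw [← integral_add hi1 hi2]
    refine setIntegral_mono_on hi (hi1.add hi2) measurableSet_Ioo fun r hr => ?_
    have hr0 : 0 < r := ha0.trans hr.1
    have he : e r ≤ r + 1 := by
      rw [e, sqrt_le_left (by linarith)]
      nlinarith
    calc e r * (1 / r ^ 2) ≤ (r + 1) * (1 / r ^ 2) := by gcongr
      _ = _ := by field_simp
  rw [integral_one_div_sq ha0 hab] at hup
  have h1 : 1 / a ≤ 1 := by rw [div_le_one ha0]; exact ha.le
  have h2 : 0 < 1 / b := by positivity
  rw [abs_le]
  constructor <;> linarith

/-- The potential energy density of the function `χ_{(a, b)}(p) / p` on `(a, b)²`. -/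
def trialDensity (z : ℝ × ℝ) : ℝ :=
  beta1 z.1 z.2 * legendreKernel (-(1 / 2)) z + beta2 z.1 z.2 * legendreKernel (1 / 2) z

theorem potentialIntegrand_trial :
    potentialIntegrand (trial a b) =
      (Ioo a b ×ˢ Ioo a b).indicator fun z => (trialDensity z : ℂ) := by
  funext z
  by_cases hz : z ∈ Ioo a b ×ˢ Ioo a b
  · rw [indicator_of_mem hz, potentialIntegrand, trial_of_mem hz.1, trial_of_mem hz.2,
      Complex.conj_ofReal, ← Complex.ofReal_mul, ← Complex.ofReal_mul]
    congr 1
    simp only [K0, trialDensity, legendreKernel]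
    ring
  · rw [indicator_of_notMem hz, potentialIntegrand]
    rw [mem_prod, not_and_or] at hz
    rcases hz with h | h <;> simp [trial_of_notMem h]

theorem abs_trialDensity_sub_le {z : ℝ × ℝ} (ha : 1 < a) (hz : z ∈ Ioo a b ×ˢ Ioo a b) :
    |trialDensity z - (1 / 2) * (legendreKernel (-(1 / 2)) z + legendreKernel (1 / 2) z)| ≤
      1 / (2 * a) * (legendreKernel (-(1 / 2)) z + legendreKernel (1 / 2) z) := by
  have ha0 : 0 < a := by linarith
  have hk : ∀ ν, 0 ≤ legendreKernel ν z := fun ν =>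
    legendreKernel_nonneg ν (ha0.trans hz.1.1) (ha0.trans hz.2.1)
  have h1 := abs_beta1_sub_le ha0 hz.1.1.le hz.2.1.le
  have h2 := abs_beta2_sub_le ha hz.1.1.le hz.2.1.le
  calc _ = |(beta1 z.1 z.2 - 1 / 2) * legendreKernel (-(1 / 2)) z +
        (beta2 z.1 z.2 - 1 / 2) * legendreKernel (1 / 2) z| := by
        congr 1; unfold trialDensity; ring
    _ ≤ |beta1 z.1 z.2 - 1 / 2| * legendreKernel (-(1 / 2)) z +
        |beta2 z.1 z.2 - 1 / 2| * legendreKernel (1 / 2) z := by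
        refine (abs_add_le _ _).trans_eq ?_
        rw [abs_mul, abs_mul, abs_of_nonneg (hk _), abs_of_nonneg (hk _)]
    _ ≤ 1 / (2 * a) * legendreKernel (-(1 / 2)) z + 1 / (2 * a) * legendreKernel (1 / 2) z := by
        have := hk (-(1 / 2))
        have := hk (1 / 2)
        gcongr
    _ = _ := by ring

theorem integrableOn_legendreKernel_add (ha : 0 < a) (hab : a < b) :
    IntegrableOn (fun z => legendreKernel (-(1 / 2)) z + legendreKernel (1 / 2) z)
      (Ioo a b ×ˢ Ioo a b) :=
  (integrableOn_legendreKernel (by norm_num) ha hab).add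
    (integrableOn_legendreKernel (by norm_num) ha hab)

theorem integrableOn_trialDensity (ha : 1 < a) (hab : a < b) :
    IntegrableOn trialDensity (Ioo a b ×ˢ Ioo a b) := by
  have hi := integrableOn_legendreKernel_add (by linarith : 0 < a) hab
  have hm : Measurable trialDensity := by
    unfold trialDensity beta1 beta2
    fun_prop
  -- Integrability is transferred from the Legendre kernels: the difference from half their sum is
  -- dominated by a multiple of that sum.
  have hd : IntegrableOn (fun z => trialDensity z -
      (1 / 2) * (legendreKernel (-(1 / 2)) z + legendreKernel (1 / 2) z))
      (Ioo a b ×ˢ Ioo a b) := by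
    refine (hi.const_mul (1 / (2 * a))).mono' (by fun_prop) ?_
    exact ae_restrict_of_forall_mem (measurableSet_Ioo.prod measurableSet_Ioo) fun z hz =>
      abs_trialDensity_sub_le ha hz
  exact (hd.add (hi.const_mul (1 / 2))).congr_fun (fun z _ => by simp)
    (measurableSet_Ioo.prod measurableSet_Ioo)

theorem integrableOn_potentialIntegrand_trial (ha : 1 < a) (hab : a < b) :
    IntegrableOn (potentialIntegrand (trial a b)) (Ioi (0 : ℝ) ×ˢ Ioi (0 : ℝ)) := by
  have h : IntegrableOn (fun z => (trialDensity z : ℂ)) (Ioo a b ×ˢ Ioo a b) :=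
    (integrableOn_trialDensity ha hab).ofReal
  rw [potentialIntegrand_trial]
  exact ((integrable_indicator_iff (measurableSet_Ioo.prod measurableSet_Ioo)).2 h).mono_measure Measure.restrict_le_self

theorem potential_trial (ha : 0 < a) :
    (potential (trial a b)).re = ∫ z in Ioo a b ×ˢ Ioo a b, trialDensity z := by
  rw [potential, potentialIntegrand_trial,
    setIntegral_indicator (measurableSet_Ioo.prod measurableSet_Ioo),
    inter_eq_self_of_subset_right
      (prod_mono (Ioo_subset_Ioi_zero ha) (Ioo_subset_Ioi_zero ha))]
  rw [integral_complex_ofReal, Complex.ofReal_re]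

/-- The logarithmic moments of the two correlation densities. -/
def logMoment : ℝ :=
  (∫⁻ p in Ioi 0, ENNReal.ofReal |log p| * arcCorrelation (-(1 / 2)) p).toReal +
    (∫⁻ p in Ioi 0, ENNReal.ofReal |log p| * arcCorrelation (1 / 2) p).toReal

theorem logMoment_nonneg : 0 ≤ logMoment := by unfold logMoment; positivity

/-- Two errors occur. Freezing the weights at `1 / 2` costs at most `S / 2 * (L / a)`; replacing the
integral `D` over the square by its leading term `L * S` costs between `0` and `logMoment`, then
halved. -/
theorem abs_potential_trial_sub_le (ha : 1 < a) (hab : a < b) :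
    |(potential (trial a b)).re - π / deltaC * log (b / a)| ≤
      ((legendreMass (-(1 / 2)) + legendreMass (1 / 2)) / 2 + logMoment / 2) *
        (log (b / a) / a + 1) := by
  have ha0 : 0 < a := by linarith
  have hL := log_div_nonneg ha0 hab
  set L := log (b / a)
  set S := legendreMass (-(1 / 2)) + legendreMass (1 / 2) with hS
  have hS0 : 0 ≤ S := add_nonneg (legendreMass_nonneg (by norm_num))
    (legendreMass_nonneg (by norm_num))
  have hm0 := logMoment_nonneg
  have hδ : π / deltaC = S / 2 := by
    rw [div_eq_mul_one_div, one_div_deltaC, ← hS]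
    field_simp
  rw [potential_trial ha0, hδ]
  set D := ∫ z in Ioo a b ×ˢ Ioo a b, (legendreKernel (-(1 / 2)) z + legendreKernel (1 / 2) z)
    with hD
  have hi := integrableOn_legendreKernel_add ha0 hab
  have hDsum := integral_add (integrableOn_legendreKernel (ν := -(1 / 2)) (by norm_num) ha0 hab)
    (integrableOn_legendreKernel (ν := 1 / 2) (by norm_num) ha0 hab)
  rw [← hD] at hDsum
  have hup : D ≤ L * S := by
    have h1 := integral_legendreKernel_le (ν := -(1 / 2)) (by norm_num) ha0 hab
    have h2 := integral_legendreKernel_le (ν := 1 / 2) (by norm_num) ha0 hab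
    rw [hDsum, hS, mul_add]
    exact add_le_add h1 h2
  have hlow : L * S ≤ D + logMoment := by
    have h1 := le_integral_legendreKernel_add (ν := -(1 / 2)) (by norm_num) ha0 hab
    have h2 := le_integral_legendreKernel_add (ν := 1 / 2) (by norm_num) ha0 hab
    rw [hDsum, hS, mul_add, logMoment]
    linarith
  have hdiff : |(∫ z in Ioo a b ×ˢ Ioo a b, trialDensity z) - 1 / 2 * D| ≤ 1 / (2 * a) * D := by
    rw [hD, ← integral_const_mul, ← integral_const_mul,
      ← integral_sub (integrableOn_trialDensity ha hab) (hi.const_mul _), ← Real.norm_eq_abs]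
    refine norm_integral_le_of_norm_le (hi.const_mul _) ?_
    exact ae_restrict_of_forall_mem (measurableSet_Ioo.prod measurableSet_Ioo) fun z hz =>
      abs_trialDensity_sub_le ha hz
  have h3 : 1 / (2 * a) * D ≤ S / 2 * (L / a) := by
    calc 1 / (2 * a) * D ≤ 1 / (2 * a) * (L * S) := by gcongr
      _ = _ := by field_simp
  have h4 : 0 ≤ L / a := by positivity
  have h5 : 0 ≤ logMoment / 2 * (L / a) := by positivity
  rw [abs_le] at hdiff ⊢
  constructor <;> nlinarith [hdiff.1, hdiff.2]

theorem abs_b0_trial_sub_le (δ : ℝ) (ha : 1 < a) (hab : a < b) :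
    |b0 δ (trial a b) - (1 - δ / deltaC) * log (b / a)| ≤
      (1 + |δ| / π * ((legendreMass (-(1 / 2)) + legendreMass (1 / 2)) / 2 + logMoment / 2)) *
        (log (b / a) / a + 1) := by
  have h1 := abs_kinetic_trial_sub_le ha hab
  have h2 := abs_potential_trial_sub_le ha hab
  have hL : 0 ≤ log (b / a) / a := div_nonneg (log_div_nonneg (by linarith) hab) (by linarith)
  calc _ = |((∫ r in Ioi 0, e r * ‖trial a b r‖ ^ 2) - log (b / a)) -
        δ / π * ((potential (trial a b)).re - π / deltaC * log (b / a))| := by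
        rw [b0]
        congr 1
        field_simp
        ring
    _ ≤ 1 + |δ| / π * (((legendreMass (-(1 / 2)) + legendreMass (1 / 2)) / 2 + logMoment / 2) *
        (log (b / a) / a + 1)) := by
        refine (abs_sub _ _).trans (add_le_add h1 ?_)
        rw [abs_mul, abs_div, abs_of_pos pi_pos]
        gcongr
    _ ≤ _ := by nlinarith

end trial

/-! ### Homogeneity of the form, choice of parameters and conclusion. -/

section scaling

variable {f : ℝ → ℂ} (c : ℝ)

theorem potentialIntegrand_const_mul :
    potentialIntegrand (fun r => (c : ℂ) * f r) =
      fun z => ((c ^ 2 : ℝ) : ℂ) * potentialIntegrand f z := by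
  funext z
  simp only [potentialIntegrand, map_mul, Complex.conj_ofReal]
  push_cast
  ring

theorem norm_const_mul_sq (r : ℝ) : ‖(c : ℂ) * f r‖ ^ 2 = c ^ 2 * ‖f r‖ ^ 2 := by
  rw [norm_mul, mul_pow, Complex.norm_real, Real.norm_eq_abs, sq_abs]

theorem normSq_const_mul : normSq (fun r => (c : ℂ) * f r) = c ^ 2 * normSq f := by
  simp_rw [normSq, norm_const_mul_sq]
  exact integral_const_mul _ _

theorem b0_const_mul (δ : ℝ) : b0 δ (fun r => (c : ℂ) * f r) = c ^ 2 * b0 δ f := by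
  simp_rw [b0, potential, potentialIntegrand_const_mul, norm_const_mul_sq, mul_left_comm (e _)]
  rw [integral_const_mul, integral_const_mul, Complex.re_ofReal_mul]
  ring

end scaling

theorem deltaC_pos : 0 < deltaC := by
  have hG : 0 < Real.Gamma (1 / 4) := Real.Gamma_pos_of_pos (by norm_num)
  unfold deltaC
  positivity

theorem exists_b0_trial_lt {δ : ℝ} (hδ : deltaC < δ) (M : ℝ) :
    ∃ a b : ℝ, 1 < a ∧ a < b ∧ b0 δ (trial a b) < M := by
  set C := 1 + |δ| / π * ((legendreMass (-(1 / 2)) + legendreMass (1 / 2)) / 2 + logMoment / 2)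
    with hC
  set κ := δ / deltaC - 1 with hκ
  have hκ0 : 0 < κ := by
    rw [hκ, sub_pos, lt_div_iff₀ deltaC_pos]
    linarith
  -- Chosen so that `|C| / a ≤ κ / 2`: the error growing with the logarithm then absorbs at most
  -- half of the gain `κ * t`.
  set a := 2 + 2 * |C| / κ with ha
  have h1 : 0 ≤ 2 * |C| / κ := by positivity
  have ha1 : 1 < a := by linarith
  have ha0 : 0 < a := by linarith
  -- Here `t` is `log (b / a)` for `b = a * exp t`. The remaining gain `κ / 2 * t = κ / 2 + |C| +
  -- |M|` beats both the constant error and `M`.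
  set t := 1 + 2 * (|C| + |M|) / κ with ht
  have ht0 : 0 < t := by positivity
  have hab : a < a * exp t := by
    have := one_lt_exp_iff.2 ht0
    nlinarith
  refine ⟨a, a * exp t, ha1, hab, ?_⟩
  have hb := (abs_le.1 (abs_b0_trial_sub_le δ ha1 hab)).2
  rw [← hC, mul_div_cancel_left₀ _ ha0.ne', log_exp] at hb
  have h2 : C * (t / a) ≤ κ / 2 * t := by
    have h3 : |C| ≤ κ / 2 * a := by
      have : κ / 2 * (2 * |C| / κ) = |C| := by field_simp
      rw [ha]
      nlinarith
    calc C * (t / a) ≤ |C| * (t / a) := by gcongr; exact le_abs_self C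
      _ ≤ κ / 2 * a * (t / a) := by gcongr
      _ = _ := by field_simp
  have h4 : κ / 2 * t = κ / 2 + |C| + |M| := by rw [ht]; field_simp; ring
  have h5 : (1 - δ / deltaC) * t = -(κ * t) := by rw [hκ]; ring
  nlinarith [le_abs_self C, neg_abs_le M]

theorem one_div_sub_one_div_le_one {a b : ℝ} (ha : 1 < a) (hab : a < b) : 1 / a - 1 / b ≤ 1 := by
  have h1 : 1 / a ≤ 1 := by rw [div_le_one (by linarith)]; exact ha.le
  have h2 : 0 < 1 / b := one_div_pos.2 (by linarith)
  linarith

theorem exists_normalized_b0_lt {δ : ℝ} (hδ : deltaC < δ) (M : ℝ) :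
    ∃ f : ℝ → ℂ, InFormDomain f ∧ normSq f = 1 ∧
      IntegrableOn (potentialIntegrand f) (Ioi (0 : ℝ) ×ˢ Ioi (0 : ℝ)) ∧ b0 δ f < M := by
  -- The target `min M 0` makes the value negative, so dividing by the squared norm `N ≤ 1` can only
  -- lower it.
  obtain ⟨a, b, ha, hab, hM⟩ := exists_b0_trial_lt hδ (min M 0)
  have ha0 : 0 < a := by linarith
  have hN := normSq_trial ha0 hab
  have hN0 : 0 < 1 / a - 1 / b := sub_pos.2 (one_div_lt_one_div_of_lt ha0 hab)
  have hN1 := one_div_sub_one_div_le_one ha hab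
  set N := 1 / a - 1 / b
  have hc : (√N)⁻¹ ^ 2 = N⁻¹ := by rw [inv_pow, sq_sqrt hN0.le]
  refine ⟨fun r => ((√N)⁻¹ : ℝ) * trial a b r, (inFormDomain_trial ha0).const_mul _, ?_, ?_, ?_⟩
  · rw [normSq_const_mul, hc, hN, inv_mul_cancel₀ hN0.ne']
  · rw [potentialIntegrand_const_mul]
    exact (integrableOn_potentialIntegrand_trial ha hab).const_mul _
  · rw [b0_const_mul, hc]
    have h1 : 1 ≤ N⁻¹ := (one_le_inv₀ hN0).2 hN1
    have h2 := hM.trans_le (min_le_left _ _)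
    have h3 := hM.trans_le (min_le_right _ _)
    nlinarith

end BrownRavenhall

end

theorem mainTheorem4 (δ : ℝ) (hδ : BrownRavenhall.deltaC < δ) :
    -- the form is unbounded from below on normalized functions of its domain
    (∀ M : ℝ, ∃ f : ℝ → ℂ, BrownRavenhall.InFormDomain f ∧ BrownRavenhall.normSq f = 1 ∧
      IntegrableOn (BrownRavenhall.potentialIntegrand f) (Ioi (0 : ℝ) ×ˢ Ioi (0 : ℝ)) ∧
      BrownRavenhall.b0 δ f < M) ∧
    -- behaviour of the form on the trial functions, uniformly in `1 < a < b`
    (∃ C : ℝ, ∀ a b : ℝ, 1 < a → a < b →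
      BrownRavenhall.InFormDomain (BrownRavenhall.trial a b) ∧
      BrownRavenhall.normSq (BrownRavenhall.trial a b) = 1 / a - 1 / b ∧
      BrownRavenhall.normSq (BrownRavenhall.trial a b) ≤ 1 ∧
      IntegrableOn (BrownRavenhall.potentialIntegrand (BrownRavenhall.trial a b))
        (Ioi (0 : ℝ) ×ˢ Ioi (0 : ℝ)) ∧
      |BrownRavenhall.b0 δ (BrownRavenhall.trial a b)
          - (1 - δ / BrownRavenhall.deltaC) * Real.log (b / a)|
        ≤ C * (Real.log (b / a) / a + 1)) ∧
    -- the integrals `I_{-1/2}` and `I_{1/2}`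
    (IntegrableOn (fun p : ℝ => 1 / p * BrownRavenhall.legendreQ (-(1 / 2)) ((p + 1 / p) / 2))
        (Ioi 0) ∧
      ∫ p in Ioi (0 : ℝ), 1 / p * BrownRavenhall.legendreQ (-(1 / 2)) ((p + 1 / p) / 2)
        = Real.Gamma (1 / 4) ^ 4 / (4 * π)) ∧
    (IntegrableOn (fun p : ℝ => 1 / p * BrownRavenhall.legendreQ (1 / 2) ((p + 1 / p) / 2))
        (Ioi 0) ∧
      ∫ p in Ioi (0 : ℝ), 1 / p * BrownRavenhall.legendreQ (1 / 2) ((p + 1 / p) / 2)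
        = 16 * π ^ 3 / Real.Gamma (1 / 4) ^ 4) := by
  open BrownRavenhall in
  exact ⟨exists_normalized_b0_lt hδ,
    ⟨1 + |δ| / π * ((legendreMass (-(1 / 2)) + legendreMass (1 / 2)) / 2 + logMoment / 2),
      fun a b ha hab =>
      have ha0 : 0 < a := one_pos.trans ha
      ⟨inFormDomain_trial ha0, normSq_trial ha0 hab,
        (normSq_trial ha0 hab).trans_le (one_div_sub_one_div_le_one ha hab),
        integrableOn_potentialIntegrand_trial ha hab, abs_b0_trial_sub_le δ ha hab⟩⟩,
    ⟨integrableOn_legendreQ (by norm_num), integral_legendreQ_neg_half⟩,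
    ⟨integrableOn_legendreQ (by norm_num), integral_legendreQ_half⟩⟩
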